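/- For a group $G$ let $\gamma_1(G)=G$, $\gamma_{i+1}(G)=[\gamma_i(G),G]$ be its lower central series and let $\widehat G=\varprojlim_i G/\gamma_i(G)$ be its pronilpotent completion (an abstract group, functorial in $G$, with canonical homomorphism $\eta_G\colon G\to\widehat G$). Write $H_2(-)=H_2(-,\mathbb Z)$ for the second integral homology of a (discrete) group. An abelian group $A$ is called cotorsion if $\mathrm{Ext}^1_{\mathbb Z}(\mathbb Q,A)=0$. Theorem B. Let $G$ be a finitely generated group and let $\varphi\colon F\twoheadrightarrow G$ be a surjective homomorphism, where $F$ is a free group of finite rank. Then the cokernel of the homomorphism $$H_2(\widehat F)\oplus H_2(G)\longrightarrow H_2(\widehat G),\qquad (a,b)\longmapsto H_2(\widehat\varphi)(a)+H_2(\eta_G)(b),$$ where $\widehat\varphi\colon\widehat F\to\widehat G$ is induced by $\varphi$, is a cotorsion group. -/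

import Mathlib

universe u

open CategoryTheory

namespace Pronilpotent

/-- `G ⧸ γ_{n+1}(G)`, where `γ₁(G) = G` and `γ_{i+1}(G) = [γ_i(G), G]`: Mathlib's lower central
series of `G` is indexed from `0`. -/
abbrev LowerQuotient (G : Type u) [Group G] (n : ℕ) : Type u :=
  G ⧸ (⊤ : Subgroup G).lowerCentralSeries n

/-- The canonical projection `G ⧸ γ_{n+1}(G) → G ⧸ γ_{m+1}(G)` for `m ≤ n`. -/
def transition (G : Type u) [Group G] {m n : ℕ} (h : m ≤ n) :
    LowerQuotient G n →* LowerQuotient G m :=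
  QuotientGroup.map _ _ (MonoidHom.id G) ((⊤ : Subgroup G).lowerCentralSeries_antitone h)

/-- The pronilpotent completion `Ĝ = lim G ⧸ γ_i(G)`, as the subgroup of compatible families in
the product of the quotients. -/
def completion (G : Type u) [Group G] : Subgroup (∀ n, LowerQuotient G n) where
  carrier := {x | ∀ (m n : ℕ) (h : m ≤ n), transition G h (x n) = x m}
  one_mem' := fun _ _ _ => map_one _
  mul_mem' := fun {x y} hx hy m n h => by
    rw [Pi.mul_apply, map_mul, hx m n h, hy m n h, Pi.mul_apply]
  inv_mem' := fun {x} hx m n h => by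
    rw [Pi.inv_apply, map_inv, hx m n h, Pi.inv_apply]

/-- The canonical homomorphism `G → Ĝ`. -/
def toCompletion (G : Type u) [Group G] : G →* completion G where
  toFun g := ⟨fun _ => (QuotientGroup.mk g), fun _ _ _ => rfl⟩
  map_one' := rfl
  map_mul' _ _ := rfl

variable {G H : Type u} [Group G] [Group H]

theorem lowerCentralSeries_le_comap (f : G →* H) (n : ℕ) :
    (⊤ : Subgroup G).lowerCentralSeries n ≤ ((⊤ : Subgroup H).lowerCentralSeries n).comap f := by
  rw [← Subgroup.map_le_iff_le_comap, Subgroup.map_lowerCentralSeries]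
  induction n with
  | zero => exact le_top
  | succ n ih => exact Subgroup.commutator_mono ih le_top

/-- The homomorphism `G ⧸ γ_{n+1}(G) → H ⧸ γ_{n+1}(H)` induced by `f : G →* H`. -/
def quotientMap (f : G →* H) (n : ℕ) : LowerQuotient G n →* LowerQuotient H n :=
  QuotientGroup.map _ _ f (lowerCentralSeries_le_comap f n)

theorem transition_quotientMap (f : G →* H) {m n : ℕ} (h : m ≤ n) (x : LowerQuotient G n) :
    transition H h (quotientMap f n x) = quotientMap f m (transition G h x) := by
  induction x using QuotientGroup.induction_on with
  | H g => rfl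

/-- The homomorphism `Ĝ → Ĥ` induced by `f : G →* H`. -/
def completionMap (f : G →* H) : completion G →* completion H where
  toFun x := ⟨fun n => quotientMap f n (x.1 n), fun m n h => by
    rw [transition_quotientMap, x.2 m n h]⟩
  map_one' := Subtype.ext (funext fun _ => map_one _)
  map_mul' _ _ := Subtype.ext (funext fun _ => map_mul _ _ _)

end Pronilpotent

namespace IntegralHomology

/-- The ring of integers in the universe `u`: Mathlib's group homology wants the coefficient ring
to live in the universe of the group. -/
abbrev ZZ : Type u := ULift.{u} ℤ

/-- The trivial `G`-module `ℤ`. -/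
abbrev trivialRep (G : Type u) [Group G] : Rep.{u} ZZ.{u} G :=
  Rep.trivial ZZ.{u} G ZZ.{u}

/-- The second integral homology group `H₂(G) = H₂(G, ℤ)`. -/
noncomputable abbrev H2 (G : Type u) [Group G] : Type u :=
  groupHomology (trivialRep G) 2

/-- The identity of `ℤ`, as a morphism of `G`-modules into the restriction along `f : G →* H` of
the trivial `H`-module `ℤ`. -/
def trivialRepHom {G H : Type u} [Group G] [Group H] (f : G →* H) :
    trivialRep G ⟶ Rep.res f (trivialRep H) :=
  Rep.ofHom ⟨LinearMap.id, fun _ => rfl⟩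

/-- The homomorphism `H₂(G) → H₂(H)` induced by `f : G →* H`. -/
noncomputable def H2Map {G H : Type u} [Group G] [Group H] (f : G →* H) : H2 G →+ H2 H :=
  (groupHomology.map f (trivialRepHom f) 2).hom.toAddMonoidHom

end IntegralHomology

/-- An abelian group `A` is cotorsion if `Ext(ℚ, A) = Ext¹_ℤ(ℚ, A) = 0`. -/
def IsCotorsion (A : Type u) [AddCommGroup A] : Prop :=
  Subsingleton (Abelian.Ext (ModuleCat.of ℤ (ULift.{u} ℚ)) (ModuleCat.of ℤ A) 1)

/-!
Let `R` be the kernel of `φ : F → G`, let `N` be the kernel of the induced map `F̂ → Ĝ`, which is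
again surjective, and let `S = N ∩ [F̂, F̂]`. By the five-term exact sequence of `N → F̂ → Ĝ`, the
group `H₂(Ĝ) / im H₂(F̂)` is a quotient of `S` (`hopfMap_surjective`). This description is natural,
so under `S → H₂(Ĝ) / im H₂(F̂)` the image of `R ∩ [F, F]` lands in the image of `H₂(G)`
(`H2Map_hopfClass`). The cokernel `C` in question is therefore a quotient of `S` by a subgroup
containing the image of `R ∩ [F, F]`, which is dense in `S` (`exists_mem_eval_eq`). Moreover `S` is
closed in `F̂`: since `F` is finitely generated, `[F̂, F̂]` is the kernel of `F̂ → F / [F, F]`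
(`mem_commutator_of_eval_one_eq_one`).

These facts make `C` cotorsion. In terms of an injective embedding, `Ext(ℚ, C) = 0` as soon as for
every sequence `aₙ` of elements of `C` the system `xₙ = aₙ + (n + 1) xₙ₊₁` has a solution
(`isCotorsion_of_exists_factorial_sum`). By density, `aₙ` is the image of an element `αₙ` of `S`
that is trivial modulo `γ_{n+1}`. Then the infinite products
`αₙ (αₙ₊₁ (αₙ₊₂ ⋯)ⁿ⁺²)ⁿ⁺¹` converge in the closed subgroup `S`, and their images in `C` solve the
system (`exists_eq_mul_pow`). These equations hold exactly in the
noncommutative group `S`, so only the commutativity of `C` matters.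

The five-term sequence is worked out by hand in the bar complex.
-/

/-! ### A criterion for cotorsion groups -/

theorem Rat.exists_eq_div_factorial (q : ℚ) {n : ℕ} (hn : q.den ≤ n) :
    ∃ m : ℤ, q = m / n.factorial := by
  obtain ⟨d, hd⟩ := Nat.dvd_factorial q.den_pos hn
  refine ⟨q.num * d, ?_⟩
  rw [eq_div_iff (by exact_mod_cast n.factorial_ne_zero), hd]
  push_cast
  rw [← mul_assoc, Rat.mul_den_eq_num]

/-- A sequence `z` in an abelian group with `z n = (n + 1) • z (n + 1)` extends to a homomorphism on
`ℚ`, the union of the cyclic groups generated by the `1 / n!`, sending `1 / n!` to `z n`. -/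
theorem Rat.exists_addMonoidHom_of_factorial_divisible {I : Type*} [AddCommGroup I] (z : ℕ → I)
    (hz : ∀ n, z n = (n + 1) • z (n + 1)) :
    ∃ h : ℚ →+ I, ∀ (n : ℕ) (m : ℤ), h (m / n.factorial) = m • z n := by
  have step : ∀ n k, z n = ((n + k).factorial / n.factorial) • z (n + k) := by
    intro n k
    induction k with
    | zero => simp [Nat.div_self (Nat.factorial_pos n)]
    | succ k ih =>
      rw [ih, hz (n + k), smul_smul, ← add_assoc, Nat.factorial_succ, mul_comm,
        Nat.mul_div_assoc _ (Nat.factorial_dvd_factorial (Nat.le_add_right n k))]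
  have fac : ∀ n : ℕ, (n.factorial : ℚ) ≠ 0 := fun n => by exact_mod_cast n.factorial_ne_zero
  have indep : ∀ (n n' : ℕ) (m m' : ℤ), (m / n.factorial : ℚ) = m' / n'.factorial →
      m • z n = m' • z n' := by
    have aux : ∀ (n k : ℕ) (m m' : ℤ), (m / n.factorial : ℚ) = m' / (n + k).factorial →
        m • z n = m' • z (n + k) := by
      intro n k m m' h
      rw [step n k, ← natCast_zsmul, smul_smul]
      congr 1
      rw [div_eq_div_iff (fac _) (fac _)] at h
      have h' : m * ((n + k).factorial : ℤ) = m' * n.factorial := by exact_mod_cast h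
      obtain ⟨d, hd⟩ := Nat.factorial_dvd_factorial (Nat.le_add_right n k)
      rw [hd, Nat.mul_div_cancel_left _ n.factorial_pos]
      have hn : (n.factorial : ℤ) ≠ 0 := by exact_mod_cast n.factorial_ne_zero
      apply mul_right_cancel₀ hn
      rw [← h', hd]; push_cast; ring
    intro n n' m m' h
    rcases le_total n n' with hle | hle
    · obtain ⟨k, rfl⟩ := Nat.exists_eq_add_of_le hle
      exact aux n k m m' h
    · obtain ⟨k, rfl⟩ := Nat.exists_eq_add_of_le hle
      exact (aux n' k m' m h.symm).symm
  choose num hnum using fun q : ℚ => q.exists_eq_div_factorial le_rfl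
  refine ⟨AddMonoidHom.mk' (fun q => num q • z q.den) fun p q => ?_, fun n m => ?_⟩
  · obtain ⟨a, ha⟩ := p.exists_eq_div_factorial (Nat.le_add_right p.den q.den)
    obtain ⟨b, hb⟩ := q.exists_eq_div_factorial (Nat.le_add_left q.den p.den)
    rw [indep _ (p.den + q.den) _ a ((hnum p).symm.trans ha),
      indep _ (p.den + q.den) _ b ((hnum q).symm.trans hb), ← add_smul]
    refine indep _ _ _ _ ((hnum _).symm.trans ?_)
    rw [Int.cast_add, add_div, ← ha, ← hb]
  · exact indep _ _ _ _ (hnum _).symm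

/-- An abelian group in which every formal sum `∑ n! • aₙ` can be evaluated, compatibly with its
tails, is cotorsion: `x n` plays the role of `aₙ + (n + 1) • (aₙ₊₁ + (n + 2) • (aₙ₊₂ + ⋯))`. -/
theorem isCotorsion_of_exists_factorial_sum {A : Type u} [AddCommGroup A]
    (h : ∀ a : ℕ → A, ∃ x : ℕ → A, ∀ n, x n = a n + (n + 1) • x (n + 1)) : IsCotorsion A := by
  unfold IsCotorsion
  refine subsingleton_of_forall_eq 0 fun e => ?_
  -- For `A ↪ I` injective, `Ext(ℚ, A)` is the obstruction to lifting maps `ℚ ⟶ I / A` to `I`.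
  let i := Injective.ι (ModuleCat.of ℤ A)
  have hS : (ShortComplex.mk i (Limits.cokernel.π i) (Limits.cokernel.condition i)).ShortExact :=
    { exact := ShortComplex.exact_cokernel i
      mono_f := inferInstanceAs (Mono i)
      epi_g := inferInstanceAs (Epi (Limits.cokernel.π i)) }
  obtain ⟨y, rfl⟩ := Abelian.Ext.covariant_sequence_exact₁ _ hS e
    (Abelian.Ext.eq_zero_of_injective _) (zero_add 1)
  obtain ⟨f, rfl⟩ := (Abelian.Ext.mk₀_bijective _ _).2 y
  have hsurj : Function.Surjective (Limits.cokernel.π i).hom :=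
    (ModuleCat.epi_iff_surjective _).1 inferInstance
  have hker : ∀ v, (Limits.cokernel.π i).hom v = 0 → ∃ a : A, i.hom a = v := fun v hv =>
    (ShortComplex.moduleCat_exact_iff _).1 hS.exact v hv
  choose y hy using fun n : ℕ => hsurj (f.hom (ULift.up (1 / (n.factorial : ℚ))))
  have hy' : ∀ n, ∃ a : A, i.hom a = y n - (n + 1) • y (n + 1) := by
    intro n
    apply hker
    rw [map_sub, map_nsmul, hy, hy, ← map_nsmul, ← map_sub]
    convert map_zero f.hom using 2
    ext
    have : (n.factorial : ℚ) ≠ 0 := by exact_mod_cast n.factorial_ne_zero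
    simp [Nat.factorial_succ]
    field_simp
    simp
  choose a ha using hy'
  -- The lifts `y n` of the images of `1 / n!` fail to be compatible by elements `a n` of `A`; the
  -- solution `x` corrects them.
  obtain ⟨x, hx⟩ := h a
  obtain ⟨g, hg⟩ := Rat.exists_addMonoidHom_of_factorial_divisible
    (fun n => y n - i.hom (x n)) (fun n => by
      dsimp only
      rw [hx n, map_add, ha, map_nsmul, smul_sub]; abel)
  let g₀ : ULift.{u} ℚ →+ (Injective.under (ModuleCat.of ℤ A) : ModuleCat.{u} ℤ) :=
    g.comp AddEquiv.ulift.toAddMonoidHom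
  let g' : ModuleCat.of ℤ (ULift.{u} ℚ) ⟶ Injective.under (ModuleCat.of ℤ A) :=
    ModuleCat.ofHom
      { g₀ with map_smul' := fun n q => by simpa using! map_intCast_smul g₀ ℤ ℤ n q }
  have hfg : f = g' ≫ Limits.cokernel.π i := by
    ext ⟨q⟩
    obtain ⟨n, m, rfl⟩ : ∃ (n : ℕ) (m : ℤ), q = m / n.factorial :=
      ⟨q.den, q.exists_eq_div_factorial le_rfl⟩
    have hq : (ULift.up ((m : ℚ) / n.factorial) : ULift.{u} ℚ) =
        m • ULift.up (1 / (n.factorial : ℚ)) := by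
      ext; simp [div_eq_mul_inv]
    have h1 : g'.hom (ULift.up ((m : ℚ) / n.factorial)) = m • (y n - i.hom (x n)) := hg n m
    have h2 : (Limits.cokernel.π i).hom (i.hom (x n)) = 0 :=
      congr($(Limits.cokernel.condition i).hom (x n))
    change f.hom _ = (Limits.cokernel.π i).hom (g'.hom _)
    rw [h1, map_zsmul, map_sub, hy, h2, sub_zero, hq, ← map_zsmul]
  rw [hfg, ← Abelian.Ext.mk₀_comp_mk₀, Abelian.Ext.comp_assoc_of_second_deg_zero]
  have := hS.comp_extClass
  dsimp only at this
  rw [this, Abelian.Ext.comp_zero]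

/-! ### The bar complex in low degrees -/

namespace IntegralHomology
open Finsupp

variable {G H : Type u} [Group G] [Group H]

/-- The boundary `[g|h] ↦ [h] - [gh] + [g]` of the bar complex with integral coefficients. -/
noncomputable def bd₂ (G : Type u) [Group G] : (G × G →₀ ZZ.{u}) →+ (G →₀ ZZ.{u}) :=
  liftAddHom fun g => singleAddHom g.2 - singleAddHom (g.1 * g.2) + singleAddHom g.1

/-- The boundary `[g|h|k] ↦ [h|k] - [gh|k] + [g|hk] - [g|h]` of the bar complex with integral
coefficients. -/
noncomputable def bd₃ (G : Type u) [Group G] : (G × G × G →₀ ZZ.{u}) →+ (G × G →₀ ZZ.{u}) :=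
  liftAddHom fun g => singleAddHom (g.2.1, g.2.2) - singleAddHom (g.1 * g.2.1, g.2.2) +
    singleAddHom (g.1, g.2.1 * g.2.2) - singleAddHom (g.1, g.2.1)

@[simp] theorem bd₂_single (g h : G) (a : ZZ.{u}) :
    bd₂ G (single (g, h) a) = single h a - single (g * h) a + single g a := by
  simp [bd₂]

@[simp] theorem bd₃_single (g h k : G) (a : ZZ.{u}) :
    bd₃ G (single (g, h, k) a) =
      single (h, k) a - single (g * h, k) a + single (g, h * k) a - single (g, h) a := by
  simp [bd₃]

theorem d₂₁_eq_bd₂ (x : G × G →₀ ZZ.{u}) : groupHomology.d₂₁ (trivialRep G) x = bd₂ G x := by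
  induction x using Finsupp.induction_linear with
  | zero => exact (map_zero (groupHomology.d₂₁ (trivialRep G)).hom).trans (map_zero (bd₂ G)).symm
  | add x y hx hy =>
    rw [map_add (bd₂ G), ← hx, ← hy]
    exact map_add (groupHomology.d₂₁ (trivialRep G)).hom x y
  | single g a => rw [bd₂_single]; exact groupHomology.d₂₁_single (A := trivialRep G) g a

theorem d₃₂_eq_bd₃ (x : G × G × G →₀ ZZ.{u}) :
    groupHomology.d₃₂ (trivialRep G) x = bd₃ G x := by
  induction x using Finsupp.induction_linear with
  | zero => exact (map_zero (groupHomology.d₃₂ (trivialRep G)).hom).trans (map_zero (bd₃ G)).symm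
  | add x y hx hy =>
    rw [map_add (bd₃ G), ← hx, ← hy]
    exact map_add (groupHomology.d₃₂ (trivialRep G)).hom x y
  | single g a => rw [bd₃_single]; exact groupHomology.d₃₂_single (A := trivialRep G) g a

/-- The homology class of a 2-cycle. -/
noncomputable def cls (G : Type u) [Group G] : (bd₂ G).ker →+ H2 G where
  toFun z := groupHomology.H2π (trivialRep G) ⟨z.1, (d₂₁_eq_bd₂ z.1).trans z.2⟩
  map_zero' := map_zero (groupHomology.H2π (trivialRep G)).hom
  map_add' x y := map_add (groupHomology.H2π (trivialRep G)).hom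
    ⟨x.1, (d₂₁_eq_bd₂ x.1).trans x.2⟩ ⟨y.1, (d₂₁_eq_bd₂ y.1).trans y.2⟩

theorem cls_surjective : Function.Surjective (cls G) := by
  intro x
  induction x using groupHomology.H2_induction_on with
  | h z => exact ⟨⟨z.1, (d₂₁_eq_bd₂ z.1).symm.trans z.2⟩, rfl⟩

theorem cls_eq_zero_iff (z : (bd₂ G).ker) : cls G z = 0 ↔ z.1 ∈ (bd₃ G).range := by
  refine (groupHomology.H2π_eq_zero_iff (A := trivialRep G) _).trans ⟨?_, ?_⟩
  · rintro ⟨y, hy⟩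
    exact ⟨y, (d₃₂_eq_bd₃ y).symm.trans hy⟩
  · rintro ⟨y, hy⟩
    exact ⟨y, (d₃₂_eq_bd₃ y).trans hy⟩

/-- The map induced by a group homomorphism on 1-chains. -/
noncomputable def map₁ (f : G →* H) : (G →₀ ZZ.{u}) →+ (H →₀ ZZ.{u}) :=
  mapDomain.addMonoidHom f

/-- The map induced by a group homomorphism on 2-chains. -/
noncomputable def map₂ (f : G →* H) : (G × G →₀ ZZ.{u}) →+ (H × H →₀ ZZ.{u}) :=
  mapDomain.addMonoidHom (Prod.map f f)

@[simp] theorem map₁_single (f : G →* H) (g : G) (a : ZZ.{u}) :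
    map₁ f (single g a) = single (f g) a := mapDomain_single

@[simp] theorem map₂_single (f : G →* H) (g h : G) (a : ZZ.{u}) :
    map₂ f (single (g, h) a) = single (f g, f h) a := mapDomain_single

theorem bd₂_map₂ (f : G →* H) (x : G × G →₀ ZZ.{u}) : bd₂ H (map₂ f x) = map₁ f (bd₂ G x) := by
  induction x using Finsupp.induction_linear with
  | zero => simp
  | add x y hx hy => simp only [map_add, hx, hy]
  | single g a => obtain ⟨g, h⟩ := g; simp

theorem H2Map_cls (f : G →* H) (z : (bd₂ G).ker) (hz : bd₂ H (map₂ f z.1) = 0) :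
    H2Map f (cls G z) = cls H ⟨map₂ f z.1, hz⟩ := by
  have := congr($(groupHomology.H2π_comp_map (A := trivialRep G) (B := trivialRep H) f
    (trivialRepHom f)).hom ⟨z.1, (d₂₁_eq_bd₂ z.1).trans z.2⟩)
  refine this.trans ?_
  refine congrArg (groupHomology.H2π (trivialRep H)).hom (Subtype.ext ?_)
  refine (groupHomology.coe_mapCycles₂ (A := trivialRep G) (B := trivialRep H) f
    (trivialRepHom f) _).trans ?_
  exact Finsupp.mapRange_id _

variable {E Q : Type u} [Group E] [Group Q]

theorem bd₂_bd₃ (x : Q × Q × Q →₀ ZZ.{u}) : bd₂ Q (bd₃ Q x) = 0 := by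
  induction x using Finsupp.induction_linear with
  | zero => simp
  | add x y hx hy => rw [map_add, map_add, hx, hy, add_zero]
  | single g a =>
    obtain ⟨g, h, k⟩ := g
    simp only [bd₃_single, map_add, map_sub, bd₂_single, mul_assoc]
    abel

/-- The degree-one homology of `E` is its abelianization, in the form needed here. -/
theorem single_mem_range_bd₂_iff (e : E) :
    single e (1 : ZZ.{u}) ∈ (bd₂ E).range ↔ e ∈ commutator E := by
  constructor
  · rintro ⟨c, hc⟩
    let θ : (E →₀ ZZ.{u}) →+ Additive (Abelianization E) :=
      liftAddHom fun g => (zmultiplesHom _ (Additive.ofMul (Abelianization.of g))).comp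
        AddEquiv.ulift.toAddMonoidHom
    have hθ : ∀ (g : E) (a : ZZ.{u}),
        θ (single g a) = a.down • Additive.ofMul (Abelianization.of g) := fun g a => by
      simp [θ]
      rfl
    have h0 : ∀ x, θ (bd₂ E x) = 0 := by
      intro x
      induction x using Finsupp.induction_linear with
      | zero => simp
      | add x y hx hy => rw [map_add, map_add, hx, hy, add_zero]
      | single g a =>
        obtain ⟨g, h⟩ := g
        simp only [bd₂_single, map_add, map_sub, hθ, map_mul, ofMul_mul, smul_add]
        abel
    have h1 := h0 c
    rw [hc, hθ, ULift.one_down, one_smul] at h1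
    rw [← Abelianization.ker_of]
    exact h1
  · let θ : E →* Multiplicative ((E →₀ ZZ.{u}) ⧸ (bd₂ E).range) :=
      MonoidHom.mk' (fun g => Multiplicative.ofAdd
        ((single g (1 : ZZ.{u}) : E →₀ ZZ.{u}) : (E →₀ ZZ.{u}) ⧸ (bd₂ E).range)) fun g h => by
        rw [← ofAdd_add, ← QuotientAddGroup.mk_add]
        refine congrArg Multiplicative.ofAdd ((QuotientAddGroup.eq).2 ⟨single (g, h) 1, ?_⟩)
        rw [bd₂_single]; abel
    intro he
    have hθ : commutator E ≤ θ.ker := by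
      rw [commutator_def, Subgroup.commutator_le]
      intro g _ h _
      rw [MonoidHom.mem_ker, map_commutatorElement, commutatorElement_eq_one_iff_mul_comm]
      exact add_comm (Multiplicative.toAdd (θ g)) (Multiplicative.toAdd (θ h))
    have h1 : θ e = 1 := hθ he
    exact (QuotientAddGroup.eq_zero_iff _).1 h1

/-! ### The Hopf map of a surjection -/

theorem map₂_sub_mem_ker {π : E →* Q} {e : E} (he : π e = 1) {c : E × E →₀ ZZ.{u}}
    (hc : bd₂ E c = single e 1) : map₂ π c - single (1, 1) 1 ∈ (bd₂ Q).ker := by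
  rw [AddMonoidHom.mem_ker, map_sub, bd₂_map₂, hc, map₁_single, he, bd₂_single]
  simp

/-- If `π e = 1` and `∂ c = [e]`, then `π c - [1|1]` is a 2-cycle of `Q`, because `∂ [1|1] = [1]`;
this is its class. For `π` surjective with kernel `N`, it is a preimage of the class of `e` under
the map `H₂(Q) → N / [N, E]` of the five-term exact sequence. -/
noncomputable def hopfClass (π : E →* Q) {e : E} (he : π e = 1) {c : E × E →₀ ZZ.{u}}
    (hc : bd₂ E c = single e 1) : H2 Q :=
  cls Q ⟨map₂ π c - single (1, 1) 1, map₂_sub_mem_ker he hc⟩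

theorem hopfClass_sub_mem_range (π : E →* Q) {e : E} (he : π e = 1) {c c' : E × E →₀ ZZ.{u}}
    (hc : bd₂ E c = single e 1) (hc' : bd₂ E c' = single e 1) :
    hopfClass π he hc - hopfClass π he hc' ∈ (H2Map π).range := by
  have h0 : bd₂ E (c - c') = 0 := by rw [map_sub, hc, hc', sub_self]
  refine ⟨cls E ⟨c - c', h0⟩, ?_⟩
  rw [H2Map_cls π _ (by rw [bd₂_map₂, h0, map_zero]), hopfClass, hopfClass, ← map_sub]
  refine congrArg (cls Q) (Subtype.ext ?_)
  simp

theorem H2Map_hopfClass {E' Q' : Type u} [Group E'] [Group Q'] {π : E →* Q} {π' : E' →* Q'}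
    {f : E →* E'} {g : Q →* Q'} (h : ∀ x, π' (f x) = g (π x)) {e : E} (he : π e = 1)
    {c : E × E →₀ ZZ.{u}} (hc : bd₂ E c = single e 1) :
    H2Map g (hopfClass π he hc) = hopfClass π' (e := f e) (c := map₂ f c)
      (by rw [h, he, map_one]) (by rw [bd₂_map₂, hc, map₁_single]) := by
  have hm : ∀ x, map₂ g (map₂ π x) = map₂ π' (map₂ f x) := by
    intro x
    induction x using Finsupp.induction_linear with
    | zero => simp
    | add x y hx hy => simp only [map_add, hx, hy]
    | single x a => obtain ⟨x, y⟩ := x; simp [h]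
  have hz : map₂ g (map₂ π c - single (1, 1) 1) = map₂ π' (map₂ f c) - single (1, 1) 1 := by
    rw [map_sub, hm, map₂_single, map_one]
  have h0 : bd₂ Q' (map₂ g (map₂ π c - single (1, 1) 1)) = 0 := by
    rw [bd₂_map₂, AddMonoidHom.mem_ker.1 (map₂_sub_mem_ker he hc), map_zero]
  refine (H2Map_cls g ⟨_, map₂_sub_mem_ker he hc⟩ h0).trans ?_
  exact congrArg (cls Q') (Subtype.ext hz)

/-- The numerator `N ∩ [E, E]` of the Hopf formula for `π : E →* Q` with kernel `N`. -/
abbrev hopfSubgroup (π : E →* Q) : Subgroup E := π.ker ⊓ commutator E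

/-- A chosen 2-chain with boundary `[s]`. -/
noncomputable def hopfChain {π : E →* Q} (s : hopfSubgroup π) : E × E →₀ ZZ.{u} :=
  ((single_mem_range_bd₂_iff s.1).2 s.2.2).choose

theorem bd₂_hopfChain {π : E →* Q} (s : hopfSubgroup π) :
    bd₂ E (hopfChain s) = single s.1 1 :=
  ((single_mem_range_bd₂_iff s.1).2 s.2.2).choose_spec

theorem mk_hopfClass_eq (π : E →* Q) {e e' : E} (hee : e = e') (he : π e = 1) (he' : π e' = 1)
    {c c' : E × E →₀ ZZ.{u}} (hc : bd₂ E c = single e 1) (hc' : bd₂ E c' = single e' 1) :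
    (hopfClass π he hc : H2 Q ⧸ (H2Map π).range) = hopfClass π he' hc' := by
  subst hee
  rw [QuotientAddGroup.eq, neg_add_eq_sub]
  exact hopfClass_sub_mem_range π he hc' hc

/-- The map `N ∩ [E, E] → H₂(Q) / im H₂(E)`, where `N` is the kernel of `π : E →* Q`, sending an
element `e` to its `hopfClass`. The choice of the chain bounding `[e]` does not matter modulo the
image of `H₂(E)`. -/
noncomputable def hopfMap (π : E →* Q) :
    hopfSubgroup π →* Multiplicative (H2 Q ⧸ (H2Map π).range) :=
  MonoidHom.mk' (fun s => Multiplicative.ofAdd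
    ((hopfClass π s.2.1 (bd₂_hopfChain s) : H2 Q) : H2 Q ⧸ (H2Map π).range)) fun s t => by
    have hc : bd₂ E (hopfChain s + hopfChain t - single (s.1, t.1) 1) = single (s * t).1 1 := by
      rw [map_sub, map_add, bd₂_hopfChain, bd₂_hopfChain, bd₂_single, Subgroup.coe_mul]
      abel
    rw [← ofAdd_add, ← QuotientAddGroup.mk_add,
      mk_hopfClass_eq π rfl (s * t).2.1 (s * t).2.1 (bd₂_hopfChain (s * t)) hc]
    simp only [hopfClass, ← map_add]
    refine congrArg (fun z => Multiplicative.ofAdd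
      ((cls Q z : H2 Q) : H2 Q ⧸ (H2Map π).range)) (Subtype.ext ?_)
    have hs : π s.1 = 1 := s.2.1
    have ht : π t.1 = 1 := t.2.1
    simp only [map_sub, map_add, map₂_single, hs, ht, AddSubgroup.coe_add]
    abel

theorem hopfMap_apply (π : E →* Q) (s : hopfSubgroup π) {c : E × E →₀ ZZ.{u}}
    (hc : bd₂ E c = single s.1 1) :
    hopfMap π s = Multiplicative.ofAdd
      ((hopfClass π s.2.1 hc : H2 Q) : H2 Q ⧸ (H2Map π).range) :=
  congrArg Multiplicative.ofAdd (mk_hopfClass_eq π rfl s.2.1 s.2.1 (bd₂_hopfChain s) hc)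

/-- The 2-chains that are integral multiples of `[1|1]` modulo boundaries. They contain all `[1|q]`
(`single_one_mem_degenerate`), and a cycle among them is a boundary. -/
noncomputable def degenerate (Q : Type u) [Group Q] : AddSubgroup (Q × Q →₀ ZZ.{u}) :=
  AddSubgroup.zmultiples (single (1, 1) 1) ⊔ (bd₃ Q).range

theorem single_one_one_mem_degenerate :
    single ((1 : Q), (1 : Q)) (1 : ZZ.{u}) ∈ degenerate Q :=
  (le_sup_left : _ ≤ degenerate Q) (AddSubgroup.mem_zmultiples _)

theorem single_one_mem_degenerate (q : Q) : single ((1 : Q), q) (1 : ZZ.{u}) ∈ degenerate Q := by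
  have h : bd₃ Q (single (1, 1, q) 1) ∈ degenerate Q :=
    (le_sup_right : _ ≤ degenerate Q) ⟨_, rfl⟩
  have := add_mem h single_one_one_mem_degenerate
  simpa using this

theorem mem_range_bd₃_of_mem_degenerate {x : Q × Q →₀ ZZ.{u}} (hx : x ∈ degenerate Q)
    (h : bd₂ Q x = 0) : x ∈ (bd₃ Q).range := by
  obtain ⟨_, ⟨k, rfl⟩, b, ⟨y, rfl⟩, rfl⟩ := AddSubgroup.mem_sup.1 hx
  -- The coefficient of `[1]` in the boundary of `k • [1|1]` is `k`.
  have hk : k = 0 := by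
    have h' := congr($h 1)
    rw [map_add, bd₂_bd₃] at h'
    simpa [ULift.ext_iff] using h'
  subst hk
  exact ⟨y, by simp⟩

/-- A 1-chain of `E` that dies in `Q` is `[n]`, for a single `n` in the kernel of `π`, plus the
boundary of a chain which becomes degenerate in `Q`: the kernel on 1-chains is generated by the
differences `[n e] - [e] = [n] - ∂ [n|e]`. -/
theorem exists_bd₂_of_map₁_eq_zero {π : E →* Q} (hπ : Function.Surjective π) {y : E →₀ ZZ.{u}}
    (hy : map₁ π y = 0) :
    ∃ (n : E) (c : E × E →₀ ZZ.{u}), π n = 1 ∧ y = single n 1 + bd₂ E c ∧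
      map₂ π c ∈ degenerate Q := by
  let W : AddSubgroup (E →₀ ZZ.{u}) :=
    { carrier := {y | ∃ (n : E) (c : E × E →₀ ZZ.{u}), π n = 1 ∧ y = single n 1 + bd₂ E c ∧
        map₂ π c ∈ degenerate Q}
      zero_mem' := by
        refine ⟨1, -single (1, 1) 1, map_one π, by simp, ?_⟩
        simpa using single_one_one_mem_degenerate
      add_mem' := by
        rintro _ _ ⟨n, c, hn, rfl, hc⟩ ⟨n', c', hn', rfl, hc'⟩
        refine ⟨n * n', c + c' + single (n, n') 1, by rw [map_mul, hn, hn', one_mul], ?_, ?_⟩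
        · simp only [map_add, bd₂_single]
          abel
        · simp only [map_add, map₂_single, hn, hn']
          exact add_mem (add_mem hc hc') single_one_one_mem_degenerate
      neg_mem' := by
        rintro _ ⟨n, c, hn, rfl, hc⟩
        refine ⟨n⁻¹, -c - single (n, n⁻¹) 1 - single (1, 1) 1, by rw [map_inv, hn, inv_one], ?_, ?_⟩
        · simp only [map_sub, map_neg, bd₂_single, mul_inv_cancel, mul_one]
          abel
        · simp only [map_sub, map_neg, map₂_single, map_inv, hn, inv_one, map_one]
          exact sub_mem (sub_mem (neg_mem hc) single_one_one_mem_degenerate)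
            single_one_one_mem_degenerate }
  have hgen : ∀ e e' : E, π e = π e' → single e 1 - single e' 1 ∈ W := by
    intro e e' h
    refine ⟨e * e'⁻¹, -single (e * e'⁻¹, e') 1, by rw [map_mul, map_inv, h, mul_inv_cancel], ?_, ?_⟩
    · simp only [map_neg, bd₂_single, inv_mul_cancel_right]
      abel
    · simp only [map_neg, map₂_single, map_mul, map_inv, h, mul_inv_cancel]
      exact neg_mem (single_one_mem_degenerate _)
  obtain ⟨s, hs⟩ := hπ.hasRightInverse
  have key : ∀ y : E →₀ ZZ.{u}, y - mapDomain.addMonoidHom s (map₁ π y) ∈ W := by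
    intro y
    induction y using Finsupp.induction_linear with
    | zero => simp
    | add x y hx hy => simpa only [map_add, add_sub_add_comm] using add_mem hx hy
    | single e a =>
      have := W.zsmul_mem (hgen e (s (π e)) (hs _).symm) a.down
      have ha : (a.down : ZZ.{u}) = a := rfl
      simpa [smul_sub, mapDomain_single, ha] using this
  have := key y
  rwa [hy, map_zero, sub_zero] at this

/-- The part of the five-term exact sequence used here: modulo the image of `H₂(E)`, every class of
`H₂(Q)` comes from an element of `N ∩ [E, E]`. -/
theorem hopfMap_surjective {π : E →* Q} (hπ : Function.Surjective π) :
    Function.Surjective (hopfMap π) := by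
  intro x
  obtain ⟨x, rfl⟩ := Multiplicative.ofAdd.surjective x
  obtain ⟨x, rfl⟩ := QuotientAddGroup.mk_surjective x
  obtain ⟨⟨z, hz⟩, rfl⟩ := cls_surjective x
  obtain ⟨z', rfl⟩ : ∃ z', map₂ π z' = z := by
    obtain ⟨s, hs⟩ := hπ.hasRightInverse
    refine ⟨mapDomain (Prod.map s s) z, ?_⟩
    refine (mapDomain_comp (v := z) (f := Prod.map s s) (g := Prod.map π π)).symm.trans ?_
    rw [Prod.map_comp_map, hs.comp_eq_id, Prod.map_id, mapDomain_id]
  obtain ⟨n, c, hn, hdc, hc⟩ := exists_bd₂_of_map₁_eq_zero hπ ((bd₂_map₂ π z').symm.trans hz)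
  have hb : bd₂ E (z' - c) = single n 1 := by rw [map_sub, hdc, add_sub_cancel_right]
  refine ⟨⟨n, hn, (single_mem_range_bd₂_iff n).1 ⟨_, hb⟩⟩, ?_⟩
  rw [hopfMap_apply π _ hb]
  refine congrArg (fun x : H2 Q => Multiplicative.ofAdd (x : H2 Q ⧸ (H2Map π).range)) ?_
  change cls Q ⟨_, map₂_sub_mem_ker hn hb⟩ = _
  rw [← sub_eq_zero, ← map_sub, cls_eq_zero_iff]
  refine mem_range_bd₃_of_mem_degenerate ?_ (AddMonoidHom.mem_ker.1 (SetLike.coe_mem _))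
  have : map₂ π (z' - c) - single (1, 1) 1 - map₂ π z' = -map₂ π c - single (1, 1) 1 := by
    rw [map_sub]; abel
  rw [AddSubgroup.coe_sub, this]
  exact sub_mem (neg_mem hc) single_one_one_mem_degenerate

end IntegralHomology

/-! ### The pronilpotent completion -/

namespace Pronilpotent

open scoped commutatorElement

variable {G H : Type u} [Group G] [Group H]

theorem transition_mk {m n : ℕ} (h : m ≤ n) (g : G) :
    transition G h (g : LowerQuotient G n) = (g : LowerQuotient G m) := rfl

/-- The projection `Ĝ → G ⧸ γ_{n+1}(G)`. -/
def completion.eval (G : Type u) [Group G] (n : ℕ) : completion G →* LowerQuotient G n :=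
  (Pi.evalMonoidHom _ n).comp (completion G).subtype

open completion

theorem completion.ext {x y : completion G} (h : ∀ n, eval G n x = eval G n y) : x = y :=
  Subtype.ext (funext h)

theorem eval_toCompletion (g : G) (n : ℕ) : eval G n (toCompletion G g) = g := rfl

theorem eval_completionMap (f : G →* H) (x : completion G) (n : ℕ) :
    eval H n (completionMap f x) = quotientMap f n (eval G n x) := rfl

theorem transition_eval {m n : ℕ} (h : m ≤ n) (x : completion G) :
    transition G h (eval G n x) = eval G m x := x.2 m n h

theorem eval_eq_of_le {m n : ℕ} (h : m ≤ n) {x y : completion G}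
    (hxy : eval G n x = eval G n y) : eval G m x = eval G m y := by
  rw [← transition_eval h, ← transition_eval h, hxy]

/-- A family that is compatible under the transition maps between consecutive quotients defines an
element of `Ĝ`. -/
theorem exists_eval_eq (x : ∀ n, LowerQuotient G n)
    (hx : ∀ n, transition G n.le_succ (x (n + 1)) = x n) :
    ∃ y : completion G, ∀ n, eval G n y = x n := by
  refine ⟨⟨x, fun m n h => ?_⟩, fun n => rfl⟩
  induction n, h using Nat.le_induction with
  | base => induction x m using QuotientGroup.induction_on with
    | H g => rfl
  | succ n h ih =>
    rw [← ih, ← hx n]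
    induction x (n + 1) using QuotientGroup.induction_on with
    | H g => rfl

theorem map_lowerCentralSeries_eq {f : G →* H} (hf : Function.Surjective f) (n : ℕ) :
    ((⊤ : Subgroup G).lowerCentralSeries n).map f = (⊤ : Subgroup H).lowerCentralSeries n := by
  rw [Subgroup.map_lowerCentralSeries, Subgroup.map_top_of_surjective f hf]

theorem mk_eq_mk_iff {n : ℕ} {g g' : G} :
    (g : LowerQuotient G n) = g' ↔ g⁻¹ * g' ∈ (⊤ : Subgroup G).lowerCentralSeries n :=
  QuotientGroup.eq

/-- For `f` surjective, congruence in the target can be lifted: this is why the towers below have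
surjective transition maps. -/
theorem exists_mk_eq_and_map_eq {f : G →* H} (hf : Function.Surjective f) {n : ℕ} {g : G} {h : H}
    (hg : (f g : LowerQuotient H n) = h) : ∃ g' : G, (g : LowerQuotient G n) = g' ∧ f g' = h := by
  rw [mk_eq_mk_iff, ← map_lowerCentralSeries_eq hf n] at hg
  obtain ⟨u, hu, hu'⟩ := hg
  exact ⟨g * u, by rwa [mk_eq_mk_iff, inv_mul_cancel_left],
    by rw [map_mul, hu', mul_inv_cancel_left]⟩

theorem completionMap_surjective {f : G →* H} (hf : Function.Surjective f) :
    Function.Surjective (completionMap f) := by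
  intro y
  have step : ∀ (n : ℕ) (g : {g : G // eval H n y = f g}),
      ∃ g' : {g : G // eval H (n + 1) y = f g}, (g'.1 : LowerQuotient G n) = g.1 := by
    rintro n ⟨g, hg⟩
    obtain ⟨h, hh⟩ := QuotientGroup.mk_surjective (eval H (n + 1) y)
    obtain ⟨g', hgg', hg'⟩ := exists_mk_eq_and_map_eq (g := g) (h := h) hf (n := n) (by
      rw [← hg, ← transition_eval n.le_succ, ← hh, transition_mk])
    exact ⟨⟨g', by rw [hg', hh]⟩, hgg'.symm⟩
  choose next hnext using step
  obtain ⟨g₀, hg₀⟩ : ∃ g : G, eval H 0 y = f g := by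
    obtain ⟨h, hh⟩ := QuotientGroup.mk_surjective (eval H 0 y)
    obtain ⟨g, rfl⟩ := hf h
    exact ⟨g, hh.symm⟩
  let s : ∀ n, {g : G // eval H n y = f g} := fun n => Nat.rec ⟨g₀, hg₀⟩ next n
  obtain ⟨x, hx⟩ := exists_eval_eq (fun n => ((s n).1 : LowerQuotient G n))
    (fun n => hnext n (s n))
  refine ⟨x, completion.ext fun n => ?_⟩
  rw [eval_completionMap, hx]
  exact (s n).2.symm

theorem eval_one_eq_one_of_mem_commutator {x : completion G} (hx : x ∈ commutator (completion G)) :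
    eval G 1 x = 1 := by
  have hle : commutator (completion G) ≤ (eval G 1).ker := by
    rw [commutator_def, Subgroup.commutator_le]
    intro x _ y _
    rw [MonoidHom.mem_ker, map_commutatorElement]
    obtain ⟨g, hg⟩ := QuotientGroup.mk_surjective (eval G 1 x)
    obtain ⟨h, hh⟩ := QuotientGroup.mk_surjective (eval G 1 y)
    rw [← hg, ← hh]
    refine (QuotientGroup.eq_one_iff ⁅g, h⁆).2 ?_
    exact Subgroup.commutator_mem_commutator (Subgroup.mem_top g) (Subgroup.mem_top h)
  exact hle hx

/-- With `R` the kernel of `f` and `N` that of the completed map, `R ∩ [G, G]` is dense in the group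
of elements of `N` that vanish in the abelianization of `G`. -/
theorem exists_mem_eval_eq {f : G →* H} (hf : Function.Surjective f) {n : ℕ} (hn : 1 ≤ n)
    {x : completion G} (hx : completionMap f x = 1) (hx1 : eval G 1 x = 1) :
    ∃ g : G, f g = 1 ∧ g ∈ commutator G ∧ eval G n x = g := by
  obtain ⟨g, hg⟩ := QuotientGroup.mk_surjective (eval G n x)
  obtain ⟨g', hgg', hg'⟩ := exists_mk_eq_and_map_eq (g := g) (h := 1) hf (n := n) (by
    have := eval_completionMap f x n
    rw [hx, ← hg] at this
    exact this.symm)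
  refine ⟨g', hg', ?_, hg.symm.trans hgg'⟩
  have h1 : (g' : LowerQuotient G 1) = 1 := by
    rw [← transition_mk hn, ← hgg', hg, transition_eval, hx1]
  rw [← Subgroup.top_lowerCentralSeries_one]
  exact (QuotientGroup.eq_one_iff g').1 h1

/-! ### Closedness of the commutator subgroup -/

section Commutators

theorem prod_map_mul_of_mem_center {ι : Type*} {K : Type*} [Group K] (l : List ι) (a b : ι → K)
    (hb : ∀ i, b i ∈ Subgroup.center K) :
    (l.map fun i => a i * b i).prod = (l.map a).prod * (l.map b).prod := by
  induction l with
  | nil => simp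
  | cons i l ih =>
    have h := Subgroup.mem_center_iff.1 (hb i)
    simp only [List.map_cons, List.prod_cons, ih, mul_assoc]
    rw [← mul_assoc (b i), ← h, mul_assoc]

/-- The product of the commutators `⁅x i, z i⁆`, in the order given by an enumeration of `ι` that is
fixed once and for all. -/
noncomputable def commProd {ι : Type*} [Fintype ι] {K : Type*} [Group K] (x z : ι → K) : K :=
  ((Finset.univ : Finset ι).toList.map fun i => ⁅x i, z i⁆).prod

variable {ι : Type*} [Fintype ι]

theorem map_commProd {K L : Type*} [Group K] [Group L] (f : K →* L) (x z : ι → K) :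
    f (commProd x z) = commProd (fun i => f (x i)) (fun i => f (z i)) := by
  simp only [commProd, map_list_prod, List.map_map, Function.comp_def, map_commutatorElement]

theorem commProd_mem_commutator {K : Type*} [Group K] (x z : ι → K) :
    commProd x z ∈ commutator K := by
  refine Subgroup.list_prod_mem _ fun y hy => ?_
  obtain ⟨i, -, rfl⟩ := List.mem_map.1 hy
  exact Subgroup.commutator_mem_commutator (Subgroup.mem_top _) (Subgroup.mem_top _)

theorem commutator_mul_right_of_mem_center {K : Type*} [Group K] {x z w : K}
    (h : ⁅x, w⁆ ∈ Subgroup.center K) : ⁅x, z * w⁆ = ⁅x, z⁆ * ⁅x, w⁆ := by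
  have h1 := Subgroup.mem_center_iff.1 h
  have : ⁅x, z * w⁆ = x * z * x⁻¹ * (⁅x, w⁆ * z⁻¹) := by
    simp only [commutatorElement_def]; group
  rw [this, ← h1]
  simp only [commutatorElement_def]; group

theorem commProd_mul {K : Type*} [Group K] {x z w : ι → K}
    (h : ∀ i, ⁅x i, w i⁆ ∈ Subgroup.center K) :
    commProd x (z * w) = commProd x z * commProd x w := by
  rw [commProd, commProd, commProd, ← prod_map_mul_of_mem_center _ _ _ h]
  simp only [Pi.mul_apply, commutator_mul_right_of_mem_center (h _)]

theorem commutator_mul_left_of_mem_center {K : Type*} [Group K] {x y w : K}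
    (h : ⁅y, w⁆ ∈ Subgroup.center K) : ⁅x * y, w⁆ = ⁅x, w⁆ * ⁅y, w⁆ := by
  have h1 := Subgroup.mem_center_iff.1 h
  have : ⁅x * y, w⁆ = x * ⁅y, w⁆ * (w * x⁻¹ * w⁻¹) := by
    simp only [commutatorElement_def]; group
  rw [this, h1, mul_assoc, ← h1]
  simp only [commutatorElement_def]; group

theorem commutator_mk_mem_center (n : ℕ) {w : G} (hw : w ∈ (⊤ : Subgroup G).lowerCentralSeries n)
    (x : G) : ⁅(x : LowerQuotient G (n + 2)), (w : LowerQuotient G (n + 2))⁆ ∈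
      Subgroup.center (LowerQuotient G (n + 2)) := by
  rw [Subgroup.mem_center_iff]
  intro y
  obtain ⟨y, rfl⟩ := QuotientGroup.mk_surjective y
  rw [← commutatorElement_eq_one_iff_mul_comm, ← commutatorElement_inv, inv_eq_one]
  refine (QuotientGroup.eq_one_iff ⁅⁅x, w⁆, y⁆).2 ?_
  refine Subgroup.commutator_mem_commutator ?_ (Subgroup.mem_top y)
  rw [← commutatorElement_inv]
  exact inv_mem (Subgroup.commutator_mem_commutator hw (Subgroup.mem_top x))

theorem commProd_one {K : Type*} [Group K] (x : ι → K) : commProd x 1 = 1 := by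
  simp [commProd]

/-- Changing the `z i` by elements of `γ_{n+1}(G)` changes the product of the `⁅x i, z i⁆`, modulo
`γ_{n+3}(G)`, by a product of commutators of the same shape. -/
theorem mk_commProd_mul (x z : ι → G) {w : ι → G} {n : ℕ}
    (hw : ∀ i, w i ∈ (⊤ : Subgroup G).lowerCentralSeries n) :
    ((commProd x (z * w) : G) : LowerQuotient G (n + 2)) =
      (commProd x z : G) * (commProd x w : G) := by
  let q := QuotientGroup.mk' ((⊤ : Subgroup G).lowerCentralSeries (n + 2))
  change q _ = q _ * q _
  have h : ∀ i, ⁅q (x i), q (w i)⁆ ∈ Subgroup.center (LowerQuotient G (n + 2)) :=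
    fun i => commutator_mk_mem_center n (hw i) (x i)
  rw [map_commProd, map_commProd, map_commProd, ← commProd_mul h]
  simp only [Pi.mul_def, map_mul]

/-- Modulo `γ_{n+3}(G)`, every element of `γ_{n+2}(G)` is a product `∏ ⁅x i, w i⁆` with one factor
for each generator `x i` of `G`, where `w i` lies in `γ_{n+1}(G)`. -/
theorem exists_commProd_eq {x : ι → G} (hx : Subgroup.closure (Set.range x) = ⊤) (n : ℕ) {u : G}
    (hu : u ∈ (⊤ : Subgroup G).lowerCentralSeries (n + 1)) :
    ∃ w : ι → G, (∀ i, w i ∈ (⊤ : Subgroup G).lowerCentralSeries n) ∧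
      (u : LowerQuotient G (n + 2)) = (commProd x w : G) := by
  classical
  let q := QuotientGroup.mk' ((⊤ : Subgroup G).lowerCentralSeries (n + 2))
  have hmul : ∀ z w : ι → G, (∀ i, w i ∈ (⊤ : Subgroup G).lowerCentralSeries n) →
      q (commProd x (z * w)) = q (commProd x z) * q (commProd x w) :=
    fun z w hw => mk_commProd_mul x z hw
  let S : Subgroup G :=
    { carrier := {u | ∃ w : ι → G, (∀ i, w i ∈ (⊤ : Subgroup G).lowerCentralSeries n) ∧
        q u = q (commProd x w)}
      one_mem' := ⟨1, fun _ => one_mem _, by rw [commProd_one]⟩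
      mul_mem' := by
        rintro a b ⟨w, hw, ha⟩ ⟨w', hw', hb⟩
        exact ⟨w * w', fun i => mul_mem (hw i) (hw' i), by rw [hmul _ _ hw', map_mul, ha, hb]⟩
      inv_mem' := by
        rintro a ⟨w, hw, ha⟩
        refine ⟨w⁻¹, fun i => inv_mem (hw i), ?_⟩
        rw [map_inv, ha, inv_eq_iff_mul_eq_one, ← hmul w w⁻¹ fun i => inv_mem (hw i),
          mul_inv_cancel, commProd_one, map_one] }
  have hgen : ∀ i, ∀ w ∈ (⊤ : Subgroup G).lowerCentralSeries n, ⁅x i, w⁆ ∈ S := by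
    intro i w hw
    refine ⟨Pi.mulSingle i w, fun j => ?_, ?_⟩
    · by_cases hij : j = i
      · subst hij; rwa [Pi.mulSingle_eq_same]
      · rw [Pi.mulSingle_eq_of_ne hij]; exact one_mem _
    · refine congrArg q ?_
      rw [commProd, List.prod_map_eq_pow_single i]
      · rw [List.count_eq_one_of_mem (Finset.nodup_toList _) (by simp), pow_one,
          Pi.mulSingle_eq_same]
      · intro j hj _
        rw [Pi.mulSingle_eq_of_ne hj, commutatorElement_one_right]
  have hall : ∀ g : G, ∀ w ∈ (⊤ : Subgroup G).lowerCentralSeries n, ⁅g, w⁆ ∈ S := by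
    intro g w hw
    have hsat : ∀ {u v : G}, v ∈ S → q u = q v → u ∈ S := fun ⟨w, hw, hv⟩ huv =>
      ⟨w, hw, huv.trans hv⟩
    have hq : ∀ g h : G, q ⁅g * h, w⁆ = q (⁅g, w⁆ * ⁅h, w⁆) := fun g h => by
      rw [map_mul, map_commutatorElement, map_commutatorElement, map_commutatorElement, map_mul]
      exact commutator_mul_left_of_mem_center (commutator_mk_mem_center n hw h)
    have hg : g ∈ Subgroup.closure (Set.range x) := hx ▸ Subgroup.mem_top g
    induction hg using Subgroup.closure_induction with
    | mem g hg => obtain ⟨i, rfl⟩ := hg; exact hgen i w hw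
    | one => rw [commutatorElement_one_left]; exact one_mem S
    | mul g h _ _ hg hh => exact hsat (mul_mem hg hh) (hq g h)
    | inv g _ hg =>
      refine hsat (inv_mem hg) ?_
      rw [map_inv, eq_inv_iff_mul_eq_one, ← map_mul, ← hq, inv_mul_cancel,
        commutatorElement_one_left, map_one]
  have hle : (⊤ : Subgroup G).lowerCentralSeries (n + 1) ≤ S := by
    rw [Subgroup.lowerCentralSeries_succ, Subgroup.commutator_le]
    intro w hw g _
    rw [← commutatorElement_inv]
    exact inv_mem (hall g w hw)
  exact hle hu

/-- For `G` finitely generated the commutator subgroup of `Ĝ` is closed, that is, it is the kernel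
of `Ĝ → G ⧸ [G, G]`: an element of this kernel is a product `∏ ⁅x i, Z i⁆` over the generators, where
the `Z i` are found by successive approximation. -/
theorem mem_commutator_of_eval_one_eq_one {ι : Type*} [Finite ι] {x : ι → G}
    (hx : Subgroup.closure (Set.range x) = ⊤) {y : completion G} (hy : eval G 1 y = 1) :
    y ∈ commutator (completion G) := by
  have := Fintype.ofFinite ι
  have step : ∀ (n : ℕ) (z : {z : ι → G // eval G (n + 1) y = (commProd x z : G)}),
      ∃ z' : {z : ι → G // eval G (n + 2) y = (commProd x z : G)},
        ∀ i, (z'.1 i : LowerQuotient G n) = z.1 i := by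
    rintro n ⟨z, hz⟩
    obtain ⟨g, hg⟩ := QuotientGroup.mk_surjective (eval G (n + 2) y)
    have hgz : ((commProd x z : G) : LowerQuotient G (n + 1)) = g := by
      rw [← hz, ← transition_eval (n + 1).le_succ, ← hg, transition_mk]
    obtain ⟨w, hw, huw⟩ := exists_commProd_eq hx n (mk_eq_mk_iff.1 hgz)
    refine ⟨⟨z * w, ?_⟩, fun i => ?_⟩
    · rw [mk_commProd_mul x z hw, ← huw, ← hg, QuotientGroup.mk_mul, QuotientGroup.mk_inv,
        mul_inv_cancel_left]
    · dsimp only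
      rw [eq_comm, mk_eq_mk_iff, Pi.mul_apply, inv_mul_cancel_left]
      exact hw i
  choose next hnext using step
  have h₀ : eval G 1 y = (commProd x 1 : G) := by
    rw [hy, commProd_one]
    rfl
  let s : ∀ n, {z : ι → G // eval G (n + 1) y = (commProd x z : G)} :=
    fun n => Nat.rec ⟨1, h₀⟩ next n
  choose Z hZ using fun i => exists_eval_eq (fun n => ((s n).1 i : LowerQuotient G n))
    (fun n => hnext n (s n) i)
  have hy' : y = commProd (fun i => toCompletion G (x i)) Z := by
    refine completion.ext fun n => ?_
    rw [map_commProd, ← transition_eval n.le_succ y, (s n).2, transition_mk]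
    simp only [hZ, eval_toCompletion]
    exact map_commProd (QuotientGroup.mk' _) x (s n).1
  rw [hy']
  exact commProd_mem_commutator _ _

end Commutators

/-! ### Infinite products and the cokernel -/

/-- In `Ĝ`, the nested infinite products
`x n = α n * (α (n + 1) * (α (n + 2) * ⋯) ^ (n + 2)) ^ (n + 1)` converge if `α n` tends to `1`; they
lie in the closure of any subgroup that contains all `α n`. -/
theorem exists_eq_mul_pow (α : ℕ → completion G) (hα : ∀ n, eval G n (α n) = 1) :
    ∃ x : ℕ → completion G, (∀ n, x n = α n * x (n + 1) ^ (n + 1)) ∧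
      ∀ S : Subgroup (completion G), (∀ n, α n ∈ S) →
        ∀ n m, ∃ s ∈ S, eval G m (x n) = eval G m s := by
  -- `P k n` is the truncation of `x n` after `k` factors; modulo `γ_{m+1}` it depends on `k` only
  -- up to `k = m - n`.
  let P : ℕ → ℕ → completion G := fun k =>
    Nat.rec (fun _ => 1) (fun _ p n => α n * p (n + 1) ^ (n + 1)) k
  have hP : ∀ k n, P (k + 1) n = α n * P k (n + 1) ^ (n + 1) := fun _ _ => rfl
  have hα' : ∀ {m n : ℕ}, m ≤ n → eval G m (α n) = 1 := fun {m n} h => by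
    rw [eval_eq_of_le h (y := 1) (by rw [hα, map_one]), map_one]
  have stable : ∀ k {m n : ℕ}, m ≤ n + k → eval G m (P (k + 1) n) = eval G m (P k n) := by
    intro k
    induction k with
    | zero =>
      intro m n h
      rw [hP, map_mul, hα' (by omega), map_pow]
      change 1 * eval G m 1 ^ (n + 1) = eval G m 1
      rw [map_one, one_pow, one_mul]
    | succ k ih =>
      intro m n h
      rw [hP (k + 1), hP k, map_mul, map_mul, map_pow, map_pow, ih (by omega)]
  choose x hx using fun n => exists_eval_eq (fun m => eval G m (P m n)) fun m => by
    rw [transition_eval, stable m (by omega)]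
  refine ⟨x, fun n => completion.ext fun m => ?_, fun S hS n m => ⟨P m n, ?_, hx n m⟩⟩
  · rw [map_mul, map_pow, hx, hx, ← map_pow, ← map_mul, ← hP, stable m (by omega)]
  · have : ∀ k n, P k n ∈ S := by
      intro k
      induction k with
      | zero => exact fun _ => one_mem S
      | succ k ih => exact fun n => mul_mem (hS n) (pow_mem (ih (n + 1)) (n + 1))
    exact this m n

open IntegralHomology in
/-- The cokernel of `H₂(F̂) ⊕ H₂(G) → H₂(Ĝ)` is cotorsion for every surjection `F → G` from a
finitely generated group. -/
theorem isCotorsion_coker {ι : Type*} {F G : Type u} [Finite ι] [Group F] [Group G] {b : ι → F}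
    (hgen : Subgroup.closure (Set.range b) = ⊤) {φ : F →* G} (hφ : Function.Surjective φ) :
    IsCotorsion (H2 (completion G) ⧸
      ((H2Map (completionMap φ)).coprod (H2Map (toCompletion G))).range) := by
  set D := ((H2Map (completionMap φ)).coprod (H2Map (toCompletion G))).range
  have hle : (H2Map (completionMap φ)).range ≤ D := by
    rintro _ ⟨x, rfl⟩
    exact ⟨(x, 0), by simp⟩
  let p : H2 (completion G) ⧸ (H2Map (completionMap φ)).range →+ H2 (completion G) ⧸ D :=
    QuotientAddGroup.map _ _ (AddMonoidHom.id _) hle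
  let Ψ : hopfSubgroup (completionMap φ) →* Multiplicative (H2 (completion G) ⧸ D) :=
    p.toMultiplicative.comp (hopfMap (completionMap φ))
  have hΨ : Function.Surjective Ψ := by
    have hp : Function.Surjective p.toMultiplicative := by
      intro x
      obtain ⟨x, rfl⟩ := Multiplicative.ofAdd.surjective x
      obtain ⟨x, rfl⟩ := QuotientAddGroup.mk_surjective x
      exact ⟨Multiplicative.ofAdd (x : H2 (completion G) ⧸ (H2Map (completionMap φ)).range), rfl⟩
    exact hp.comp (hopfMap_surjective (completionMap_surjective hφ))
  have hcomm : ∀ g, completionMap φ (toCompletion F g) = toCompletion G (φ g) := fun _ => rfl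
  -- Elements of `ker φ ∩ [F, F]` are sent into the image of `H₂(G)`, by naturality of the Hopf map.
  have hη : ∀ g : F, φ g = 1 → g ∈ commutator F →
      ∃ s : hopfSubgroup (completionMap φ), s.1 = toCompletion F g ∧ Ψ s = 1 := by
    intro g hg hg'
    obtain ⟨c, hc⟩ := (single_mem_range_bd₂_iff g).2 hg'
    have hc' : bd₂ (completion F) (map₂ (toCompletion F) c) =
        Finsupp.single (toCompletion F g) 1 := by rw [bd₂_map₂, hc, map₁_single]
    let s : hopfSubgroup (completionMap φ) :=
      ⟨toCompletion F g, (hcomm g).trans (by rw [hg, map_one]),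
        (single_mem_range_bd₂_iff _).1 ⟨_, hc'⟩⟩
    refine ⟨s, rfl, ?_⟩
    change p.toMultiplicative (hopfMap _ s) = 1
    rw [hopfMap_apply _ s hc', ← H2Map_hopfClass hcomm hg hc]
    exact (QuotientAddGroup.eq_zero_iff _).2 ⟨(0, hopfClass φ hg hc), by simp⟩
  refine isCotorsion_of_exists_factorial_sum fun a => ?_
  -- Hence preimages under `Ψ` can be moved arbitrarily close to `1`.
  have hlift : ∀ n, ∃ s : hopfSubgroup (completionMap φ),
      Ψ s = Multiplicative.ofAdd (a n) ∧ eval F n s.1 = 1 := by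
    intro n
    obtain ⟨s, hs⟩ := hΨ (Multiplicative.ofAdd (a n))
    obtain ⟨g, hg, hg', hsg⟩ := exists_mem_eval_eq hφ (Nat.le_add_left 1 n) s.2.1
      (eval_one_eq_one_of_mem_commutator s.2.2)
    obtain ⟨t, ht, ht'⟩ := hη g hg hg'
    refine ⟨s * t⁻¹, by rw [map_mul, map_inv, ht', hs, inv_one, mul_one], ?_⟩
    rw [Subgroup.coe_mul, Subgroup.coe_inv, map_mul, map_inv, ht, mul_inv_eq_one]
    exact eval_eq_of_le n.le_succ hsg
  choose α hα hα' using hlift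
  obtain ⟨x, hx, hxS⟩ := exists_eq_mul_pow (fun n => (α n).1) hα'
  have hmem : ∀ n, x n ∈ hopfSubgroup (completionMap φ) := by
    refine fun n => ⟨?_, mem_commutator_of_eval_one_eq_one hgen ?_⟩
    · refine completion.ext fun m => ?_
      obtain ⟨s, hs, hs'⟩ := hxS _ (fun n => (α n).2) n m
      rw [eval_completionMap, hs', ← eval_completionMap, (hs.1 : completionMap φ s = 1)]
    · obtain ⟨s, hs, hs'⟩ := hxS _ (fun n => (α n).2) n 1
      rw [hs', eval_one_eq_one_of_mem_commutator hs.2]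
  refine ⟨fun n => Multiplicative.toAdd (Ψ ⟨x n, hmem n⟩), fun n => ?_⟩
  have hxn : (⟨x n, hmem n⟩ : hopfSubgroup (completionMap φ)) =
      α n * ⟨x (n + 1), hmem (n + 1)⟩ ^ (n + 1) := Subtype.ext (hx n)
  dsimp only
  rw [hxn, map_mul, map_pow, hα]
  rfl

end Pronilpotent

theorem FreeGroupBasis.closure_range_eq_top {ι F : Type*} [Group F] (b : FreeGroupBasis ι F) :
    Subgroup.closure (Set.range b) = ⊤ := by
  have h := congrArg (Subgroup.map b.repr.symm.toMonoidHom) (FreeGroup.closure_range_of ι)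
  rwa [MonoidHom.map_closure, ← Set.range_comp,
    Subgroup.map_top_of_surjective _ b.repr.symm.surjective] at h

theorem theoremB {ι : Type*} {F G : Type u} [Finite ι] [Group F] [Group G]
    (b : FreeGroupBasis ι F) (φ : F →* G) (hφ : Function.Surjective φ) :
    IsCotorsion
      (IntegralHomology.H2 (Pronilpotent.completion G) ⧸
        ((IntegralHomology.H2Map (Pronilpotent.completionMap φ)).coprod
          (IntegralHomology.H2Map (Pronilpotent.toCompletion G))).range) :=
  Pronilpotent.isCotorsion_coker b.closure_range_eq_top hφ
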